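/- Consider an FLRW universe: the line element $$ds^2=-dt^2+\frac{R(t)^2}{\left(1+\frac14\varepsilon r^2\right)^2}\,(dr^2+r^2d\Omega^2),\qquad \varepsilon\in\{0,1,-1\},$$ where $dr^2+r^2d\Omega^2$ is the Euclidean metric of $\mathbb R^3$, $t$ runs over an open interval $I$, the spatial point $x^i$ runs over a connected open set $D\subseteq\mathbb R^3$ on which $1+\frac14\varepsilon r^2\neq0$, and $R>0$ is an expansion factor of class $C^m$ on $I$ ($1\le m\le\infty$). Let $R_0>0$ be a constant. The cosmological observer is $u=\partial_t$ (as a covector, $u=-dt$). A classical ideal gas (CIG) is given by two constants $k>0$, $c_v>0$; its adiabatic index is $\gamma=1+k/c_v>1$. The fundamental system of the CIG hydrodynamics in a given spacetime, for a unit time-like velocity $u$ with acceleration $a=\nabla_u u$ and expansion $\theta=\nabla\cdot u$, and for the energy density $\rho$, pressure $p>0$, matter density $n>0$, specific internal energy $\epsilon$, specific entropy $s$ and temperature $\Theta$, consists of $$dp+\dot p\,u+(\rho+p)a=0,\quad \dot\rho+(\rho+p)\theta=0,\quad \rho=n(1+\epsilon),\quad \nabla\cdot(nu)=0,$$ $$\Theta\,ds=d\epsilon+p\,d(1/n),\quad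 p=kn\Theta,\quad \epsilon=c_v\Theta,$$ where $\dot q=u(q)$. A test solution is a solution of class $C^m$ of this system in the given metric (no Einstein equation relating the metric and the fluid is imposed). Proposition. (1) In any FLRW universe, for every $\gamma>1$ and every $k>0$, there are a CIG with constant $k$ and adiabatic index $\gamma$ and a test solution of its fundamental system which is comoving with the cosmological observer. (2) Let a CIG with adiabatic index $\gamma$ be given. A comoving fluid $(u=\partial_t,\rho,p,n,\epsilon,s,\Theta)$ is a test solution of its fundamental system if and only if there are a constant $p_0>0$, a positive $C^m$ function $N(x^i)$ of the spatial coordinates and a constant $s_0$ such that $$\rho=N(x^i)\left(\frac{R_0}{R}\right)^{3}+\frac{p_0}{\gamma-1}\left(\frac{R_0}{R}\right)^{3\gamma},\qquad p=p_0\left(\frac{R_0}{R}\right)^{3\gamma},$$ $$n=N(x^i)\left(\frac{R_0}{R}\right)^{3},\qquad \Theta=\frac{p_0}{kN(x^i)}\left(\frac{R_0}{R}\right)^{3(\gamma-1)},$$ $$\epsilon=\frac{p}{(\gamma-1)\rho-p},\qquad s=s_0+c_v\ln\frac{p}{[\rho(\gamma-1)-p]^{\gamma}}.$$ -/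

import Mathlib

noncomputable section

namespace ClassicalIdealGas

/-! ### Tensor calculus in a coordinate domain of a four-dimensional spacetime

Points are coordinate quadruples `x = (x⁰, x¹, x², x³)`; a metric is given by its matrix of
components `g x`, of signature `(-,+,+,+)`; vector fields are given by their contravariant
components. -/

/-- Coordinate quadruples (also used for the components of vectors and covectors). -/
abbrev Coord : Type := Fin 4 → ℝ

/-- The partial derivative `∂_μ f`. -/
def partialD (μ : Fin 4) (f : Coord → ℝ) (x : Coord) : ℝ :=
  fderiv ℝ f x (Pi.single μ 1)

/-- The Christoffel symbol
`Γ^l_{μν} = ½ g^{lσ} (∂_μ g_{σν} + ∂_ν g_{σμ} - ∂_σ g_{μν})` of the Levi-Civita connection. -/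
def christoffel (g : Coord → Matrix (Fin 4) (Fin 4) ℝ) (l μ ν : Fin 4) (x : Coord) : ℝ :=
  (1 / 2) * ∑ σ, (g x)⁻¹ l σ *
    (partialD μ (fun y => g y σ ν) x + partialD ν (fun y => g y σ μ) x
      - partialD σ (fun y => g y μ ν) x)

/-- The covariant derivative `∇_μ v^ν = ∂_μ v^ν + Γ^ν_{μl} v^l`. -/
def covD (g : Coord → Matrix (Fin 4) (Fin 4) ℝ) (v : Coord → Coord) (μ ν : Fin 4)
    (x : Coord) : ℝ :=
  partialD μ (fun y => v y ν) x + ∑ l, christoffel g ν μ l x * v x l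

/-- The divergence `∇ · v = ∇_μ v^μ`. -/
def divergence (g : Coord → Matrix (Fin 4) (Fin 4) ℝ) (v : Coord → Coord) (x : Coord) : ℝ :=
  ∑ μ, covD g v μ μ x

/-- Covariant components `v_μ = g_{μν} v^ν`. -/
def lower (g : Coord → Matrix (Fin 4) (Fin 4) ℝ) (v : Coord → Coord) (x : Coord) : Coord :=
  fun μ => ∑ ν, g x μ ν * v x ν

/-- The metric square `g(v, v)`. -/
def metricSq (g : Coord → Matrix (Fin 4) (Fin 4) ℝ) (v : Coord → Coord) (x : Coord) : ℝ :=
  ∑ μ, lower g v x μ * v x μ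

/-- The directional derivative `u(q) = u^α ∂_α q` (written `q̇`). -/
def dot (u : Coord → Coord) (q : Coord → ℝ) (x : Coord) : ℝ :=
  ∑ α, u x α * partialD α q x

/-- The expansion `θ = ∇ · u`. -/
def expansion (g : Coord → Matrix (Fin 4) (Fin 4) ℝ) (u : Coord → Coord) (x : Coord) : ℝ :=
  divergence g u x

/-- The acceleration vector `a = ∇_u u`, i.e. `a^ν = u^μ ∇_μ u^ν`. -/
def acceleration (g : Coord → Matrix (Fin 4) (Fin 4) ℝ) (u : Coord → Coord) (x : Coord) : Coord :=
  fun ν => ∑ μ, u x μ * covD g u μ ν x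

/-! ### Classical ideal gases and the fundamental system of their hydrodynamics -/

/-- The material constants of a classical ideal gas: `k = k_B / m` and the heat capacity at
constant volume `c_v`. -/
structure Gas where
  k : ℝ
  cv : ℝ
  k_pos : 0 < k
  cv_pos : 0 < cv

/-- The adiabatic index `γ = 1 + k / c_v`. -/
def Gas.adiabaticIndex (G : Gas) : ℝ := 1 + G.k / G.cv

/-- The hydrodynamic and thermodynamic quantities of a fluid: velocity `u`, energy density `ρ`,
pressure `p`, matter density `n`, specific internal energy `e`, specific entropy `s`,
temperature `Θ`. -/
structure Fluid where
  u : Coord → Coord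
  ρ : Coord → ℝ
  p : Coord → ℝ
  n : Coord → ℝ
  e : Coord → ℝ
  s : Coord → ℝ
  Θ : Coord → ℝ

/-- `F` is a solution of class `C^r` on the open set `U`, in the given spacetime metric `g`, of the
fundamental system of the hydrodynamics of the classical ideal gas `G`. (It is a test solution:
no relation between `g` and the energy tensor of `F` is imposed.) -/
structure IsCIGSolution (r : ℕ∞) (g : Coord → Matrix (Fin 4) (Fin 4) ℝ) (U : Set Coord)
    (G : Gas) (F : Fluid) : Prop where
  contDiffOn_u : ContDiffOn ℝ r F.u U
  contDiffOn_ρ : ContDiffOn ℝ r F.ρ U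
  contDiffOn_p : ContDiffOn ℝ r F.p U
  contDiffOn_n : ContDiffOn ℝ r F.n U
  contDiffOn_e : ContDiffOn ℝ r F.e U
  contDiffOn_s : ContDiffOn ℝ r F.s U
  contDiffOn_Θ : ContDiffOn ℝ r F.Θ U
  /-- `u` is a unit time-like vector field. -/
  unit : ∀ x ∈ U, metricSq g F.u x = -1
  /-- `dp + ṗ u + (ρ + p) a = 0`. -/
  momentum : ∀ x ∈ U, ∀ μ, partialD μ F.p x + dot F.u F.p x * lower g F.u x μ
    + (F.ρ x + F.p x) * lower g (acceleration g F.u) x μ = 0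
  /-- `ρ̇ + (ρ + p) θ = 0`. -/
  energy : ∀ x ∈ U, dot F.u F.ρ x + (F.ρ x + F.p x) * expansion g F.u x = 0
  /-- `ρ = n (1 + e)`. -/
  decomposition : ∀ x ∈ U, F.ρ x = F.n x * (1 + F.e x)
  /-- The matter density is positive. -/
  n_pos : ∀ x ∈ U, 0 < F.n x
  /-- Conservation of matter, `∇ · (n u) = 0`. -/
  matter : ∀ x ∈ U, divergence g (fun y => F.n y • F.u y) x = 0
  /-- Local thermal equilibrium, `Θ ds = de + p d(1/n)`. -/
  thermal : ∀ x ∈ U, ∀ μ, F.Θ x * partialD μ F.s x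
    = partialD μ F.e x + F.p x * partialD μ (fun y => 1 / F.n y) x
  /-- Equation of state `p = k n Θ`. -/
  state_p : ∀ x ∈ U, F.p x = G.k * F.n x * F.Θ x
  /-- Positive pressure. -/
  p_pos : ∀ x ∈ U, 0 < F.p x
  /-- Equation of state `e = c_v Θ`. -/
  state_e : ∀ x ∈ U, F.e x = G.cv * F.Θ x

/-! ### Friedmann-Lemaître-Robertson-Walker universes -/

/-- The spatial coordinates `(x¹, x², x³)` of a point. -/
def spatial (x : Coord) : Fin 3 → ℝ := fun i => x i.succ

/-- The factor `1 + ¼ κ r²`, where `r² = (x¹)² + (x²)² + (x³)²`. -/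
def curvatureFactor (κ : ℝ) (y : Fin 3 → ℝ) : ℝ := 1 + (1 / 4) * κ * ∑ i, y i ^ 2

/-- The line element `-dt² + R(t)² / (1 + ¼ κ r²)² (dr² + r² dΩ²)`, with the Euclidean metric
`dr² + r² dΩ²` written in Cartesian coordinates as `(dx¹)² + (dx²)² + (dx³)²`, and `x⁰ = t`. -/
def flrwMetric (κ : ℝ) (R : ℝ → ℝ) (x : Coord) : Matrix (Fin 4) (Fin 4) ℝ :=
  Matrix.diagonal
    ![-1,
      R (x 0) ^ 2 / curvatureFactor κ (spatial x) ^ 2,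
      R (x 0) ^ 2 / curvatureFactor κ (spatial x) ^ 2,
      R (x 0) ^ 2 / curvatureFactor κ (spatial x) ^ 2]

/-- The points with cosmological time in `I` and spatial coordinates in `D`. -/
def flrwDomain (I : Set ℝ) (D : Set (Fin 3 → ℝ)) : Set Coord :=
  {x | x 0 ∈ I ∧ spatial x ∈ D}

/-- The cosmological observer `∂_t` (as a covector, `-dt`). -/
def cosmologicalObserver : Coord → Coord := fun _ => Pi.single 0 1

/-- The fluid `F` is comoving with the cosmological observer on `U`. -/
def Fluid.IsComoving (F : Fluid) (U : Set Coord) : Prop :=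
  ∀ x ∈ U, F.u x = cosmologicalObserver x

end ClassicalIdealGas

end

namespace ClassicalIdealGas

open Filter Topology

/-! ### Partial derivatives -/

theorem _root_.HasFDerivAt.partialD {f : Coord → ℝ} {f' : Coord →L[ℝ] ℝ} {x : Coord}
    (h : HasFDerivAt f f' x) (μ : Fin 4) : partialD μ f x = f' (Pi.single μ 1) := by
  rw [ClassicalIdealGas.partialD, h.fderiv]

theorem partialD_congr {f g : Coord → ℝ} {x : Coord} (h : f =ᶠ[𝓝 x] g) (μ : Fin 4) :
    partialD μ f x = partialD μ g x := by
  rw [partialD, partialD, h.fderiv_eq]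

theorem partialD_const (μ : Fin 4) (c : ℝ) (x : Coord) : partialD μ (fun _ => c) x = 0 := by
  simp [partialD]

theorem partialD_add {f g : Coord → ℝ} {x : Coord} (hf : DifferentiableAt ℝ f x)
    (hg : DifferentiableAt ℝ g x) (μ : Fin 4) :
    partialD μ (fun y => f y + g y) x = partialD μ f x + partialD μ g x := by
  rw [(hf.hasFDerivAt.fun_add hg.hasFDerivAt).partialD]; rfl

theorem partialD_mul {f g : Coord → ℝ} {x : Coord} (hf : DifferentiableAt ℝ f x)
    (hg : DifferentiableAt ℝ g x) (μ : Fin 4) :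
    partialD μ (fun y => f y * g y) x = f x * partialD μ g x + partialD μ f x * g x := by
  rw [(hf.hasFDerivAt.fun_mul hg.hasFDerivAt).partialD]
  simp [partialD, mul_comm]

/-- Chain rule for a function of one real variable. -/
theorem partialD_comp {f : Coord → ℝ} {φ : ℝ → ℝ} {φ' : ℝ} {x : Coord}
    (hφ : HasDerivAt φ φ' (f x)) (hf : DifferentiableAt ℝ f x) (μ : Fin 4) :
    partialD μ (fun y => φ (f y)) x = φ' * partialD μ f x := by
  have h := hφ.comp_hasFDerivAt x hf.hasFDerivAt
  have h2 := h.partialD μ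
  simpa [partialD, Function.comp_def] using h2

theorem hasFDerivAt_time (x : Coord) :
    HasFDerivAt (fun y : Coord => y 0)
      (ContinuousLinearMap.proj (R := ℝ) (φ := fun _ : Fin 4 => ℝ) 0) x :=
  (ContinuousLinearMap.proj (R := ℝ) (φ := fun _ : Fin 4 => ℝ) 0).hasFDerivAt

theorem partialD_time_zero {φ : ℝ → ℝ} {φ' : ℝ} {x : Coord} (hφ : HasDerivAt φ φ' (x 0)) :
    partialD 0 (fun y => φ (y 0)) x = φ' := by
  rw [partialD_comp (f := fun y => y 0) hφ (hasFDerivAt_time x).differentiableAt,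
    (hasFDerivAt_time x).partialD]
  simp

theorem partialD_time_succ {φ : ℝ → ℝ} {x : Coord} (hφ : DifferentiableAt ℝ φ (x 0)) (i : Fin 3) :
    partialD i.succ (fun y => φ (y 0)) x = 0 := by
  rw [partialD_comp (f := fun y => y 0) hφ.hasDerivAt (hasFDerivAt_time x).differentiableAt,
    (hasFDerivAt_time x).partialD]
  simp [(Fin.succ_ne_zero i).symm]

/-- The projection to the spatial coordinates, as a continuous linear map. -/
def spatialCLM : Coord →L[ℝ] (Fin 3 → ℝ) :=
  ContinuousLinearMap.pi fun i => ContinuousLinearMap.proj i.succ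

theorem contDiff_spatial {m : WithTop ℕ∞} : ContDiff ℝ m spatial := spatialCLM.contDiff

theorem partialD_zero_spatial {N : (Fin 3 → ℝ) → ℝ} {x : Coord}
    (hN : DifferentiableAt ℝ N (spatial x)) :
    partialD 0 (fun y => N (spatial y)) x = 0 := by
  have h : HasFDerivAt (fun y : Coord => N (spatial y))
      ((fderiv ℝ N (spatial x)).comp spatialCLM) x :=
    HasFDerivAt.comp x hN.hasFDerivAt (spatialCLM.hasFDerivAt (x := x))
  rw [h.partialD]
  have : spatialCLM (Pi.single 0 1) = 0 := by
    ext i; simp [spatialCLM]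
  simp [this]

/-- A function with vanishing partial derivatives on a connected open set is constant there. -/
theorem exists_const_of_partialD_eq_zero {U : Set Coord} (hU : IsOpen U) (hc : IsConnected U)
    {f : Coord → ℝ} (hf : DifferentiableOn ℝ f U) (h : ∀ x ∈ U, ∀ μ, partialD μ f x = 0) :
    ∃ c, ∀ x ∈ U, f x = c := by
  refine hU.exists_is_const_of_fderiv_eq_zero hc.isPreconnected hf fun x hx => ?_
  ext v
  rw [← Finset.univ_sum_single v, map_sum]
  simp only [Pi.zero_apply, zero_apply]
  refine Finset.sum_eq_zero fun μ _ => ?_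
  have : (Pi.single μ (v μ) : Coord) = v μ • Pi.single μ 1 := by
    rw [← Pi.single_smul]; simp
  rw [this, map_smul, show fderiv ℝ f x (Pi.single μ 1) = 0 from h x hx μ, smul_zero]

/-! ### The coordinate domain -/

/-- The point with time `t` and spatial coordinates `y`. -/
def event (t : ℝ) (y : Fin 3 → ℝ) : Coord := Fin.cons t y

theorem event_time_spatial (x : Coord) : event (x 0) (spatial x) = x :=
  Fin.cons_self_tail x

theorem contDiff_event {m : WithTop ℕ∞} : ContDiff ℝ m fun q : ℝ × (Fin 3 → ℝ) => event q.1 q.2 := by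
  rw [contDiff_pi]
  intro i
  refine Fin.cases ?_ (fun i => ?_) i
  · exact contDiff_fst
  · exact (contDiff_apply ℝ ℝ i).comp contDiff_snd

theorem hasDerivAt_event (t : ℝ) (y : Fin 3 → ℝ) :
    HasDerivAt (fun t => event t y) (Pi.single 0 1) t := by
  rw [hasDerivAt_pi]
  intro i
  refine Fin.cases ?_ (fun i => ?_) i
  · simpa [event] using hasDerivAt_id' t
  · simpa [event] using hasDerivAt_const t (y i)

theorem isOpen_flrwDomain {I : Set ℝ} {D : Set (Fin 3 → ℝ)} (hI : IsOpen I) (hD : IsOpen D) :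
    IsOpen (flrwDomain I D) :=
  (hI.preimage (continuous_apply 0)).inter (hD.preimage spatialCLM.continuous)

theorem isConnected_flrwDomain {I : Set ℝ} {D : Set (Fin 3 → ℝ)} (hI : IsConnected I)
    (hD : IsConnected D) : IsConnected (flrwDomain I D) := by
  have h := (hI.prod hD).image (fun q : ℝ × (Fin 3 → ℝ) => event q.1 q.2)
    (contDiff_event (m := 0)).continuous.continuousOn
  convert h using 1
  ext x
  constructor
  · exact fun hx => ⟨(x 0, spatial x), hx, event_time_spatial x⟩
  · rintro ⟨q, hq, rfl⟩
    exact hq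

/-- A function with vanishing time derivative depends on the spatial coordinates only. -/
theorem eq_of_partialD_zero_eq_zero {I : Set ℝ} {D : Set (Fin 3 → ℝ)} (hI_open : IsOpen I)
    (hI : IsConnected I) {f : Coord → ℝ}
    (hf : ∀ x ∈ flrwDomain I D, DifferentiableAt ℝ f x)
    (h : ∀ x ∈ flrwDomain I D, partialD 0 f x = 0) {t₀ : ℝ} (ht₀ : t₀ ∈ I) {x : Coord}
    (hx : x ∈ flrwDomain I D) : f x = f (event t₀ (spatial x)) := by
  have key : ∀ t ∈ I, HasDerivAt (fun t => f (event t (spatial x))) 0 t := by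
    intro t ht
    have hU : event t (spatial x) ∈ flrwDomain I D := ⟨ht, hx.2⟩
    have := (hf _ hU).hasFDerivAt.comp_hasDerivAt t (hasDerivAt_event t (spatial x))
    rwa [show fderiv ℝ f (event t (spatial x)) (Pi.single 0 1) = 0 from h _ hU] at this
  have := hI_open.is_const_of_deriv_eq_zero hI.isPreconnected
    (fun t ht => (key t ht).differentiableAt.differentiableWithinAt)
    (fun t ht => (key t ht).deriv) hx.1 ht₀
  simpa only [event_time_spatial] using this

/-! ### Connection coefficients of an FLRW universe -/

section Connection

variable {κ : ℝ} {R : ℝ → ℝ} {x : Coord}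

/-- The diagonal components of the FLRW metric. -/
theorem flrwMetric_apply (y : Coord) (μ ν : Fin 4) :
    flrwMetric κ R y μ ν = if μ = ν then
      (if μ = 0 then -1 else R (y 0) ^ 2 * (curvatureFactor κ (spatial y) ^ 2)⁻¹) else 0 := by
  rw [flrwMetric, Matrix.diagonal_apply]
  split_ifs with h1 h2
  · subst h2; rfl
  · obtain ⟨i, rfl⟩ := Fin.exists_succ_eq.2 h2
    fin_cases i <;> rfl
  · rfl

theorem flrwMetric_inv_apply (hR : R (x 0) ≠ 0) (hc : curvatureFactor κ (spatial x) ≠ 0)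
    (μ ν : Fin 4) :
    (flrwMetric κ R x)⁻¹ μ ν = if μ = ν then (flrwMetric κ R x μ μ)⁻¹ else 0 := by
  have : (flrwMetric κ R x)⁻¹ = Matrix.diagonal fun μ => (flrwMetric κ R x μ μ)⁻¹ := by
    refine Matrix.inv_eq_right_inv ?_
    ext i j
    rw [Matrix.mul_diagonal, flrwMetric_apply, flrwMetric_apply, Matrix.one_apply]
    split_ifs <;> simp_all
    field_simp
  rw [this, Matrix.diagonal_apply]

theorem differentiable_curvatureFactor : Differentiable ℝ (curvatureFactor κ) := by
  unfold curvatureFactor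
  fun_prop

theorem christoffel_flrwMetric_zero (hR : R (x 0) ≠ 0) (hd : DifferentiableAt ℝ R (x 0))
    (hc : curvatureFactor κ (spatial x) ≠ 0) (ν μ : Fin 4) :
    christoffel (flrwMetric κ R) ν μ 0 x =
      if ν = μ ∧ ν ≠ 0 then deriv R (x 0) / R (x 0) else 0 := by
  have h0 : ∀ α β : Fin 4, partialD α (fun y => flrwMetric κ R y β 0) x = 0 := by
    intro α β
    have : (fun y => flrwMetric κ R y β 0) = fun _ => if β = 0 then -1 else 0 := by
      ext y
      rw [flrwMetric_apply]
      split_ifs <;> rfl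
    rw [this, partialD_const]
  simp only [christoffel, flrwMetric_inv_apply hR hc, ite_mul, zero_mul, Finset.sum_ite_eq,
    Finset.mem_univ, if_true, h0, zero_add, sub_zero]
  by_cases hνμ : ν = μ
  · subst hνμ
    by_cases hν : ν = 0
    · subst hν
      simp [h0]
    · simp only [flrwMetric_apply, if_true, hν, if_false, ne_eq, not_false_eq_true, and_self]
      have hw : DifferentiableAt ℝ (fun z => (curvatureFactor κ z ^ 2)⁻¹) (spatial x) :=
        ((differentiable_curvatureFactor _).pow 2).inv (pow_ne_zero 2 hc)
      have hw' : DifferentiableAt ℝ (fun y => (curvatureFactor κ (spatial y) ^ 2)⁻¹) x :=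
        hw.comp x (spatialCLM.differentiableAt (x := x))
      have hR2 : HasDerivAt (fun t => R t ^ 2) (2 * R (x 0) * deriv R (x 0)) (x 0) := by
        simpa using hd.hasDerivAt.fun_pow 2
      have hR2' : DifferentiableAt ℝ (fun y : Coord => R (y 0) ^ 2) x :=
        DifferentiableAt.comp (g := fun t => R t ^ 2) (f := fun y : Coord => y 0) x
          hR2.differentiableAt (hasFDerivAt_time x).differentiableAt
      rw [partialD_mul hR2' hw', partialD_time_zero (φ := fun t => R t ^ 2) hR2,
        partialD_zero_spatial (N := fun z => (curvatureFactor κ z ^ 2)⁻¹) hw]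
      field_simp
      ring
  · have : (fun y => flrwMetric κ R y ν μ) = fun _ => 0 := by
      ext y
      rw [flrwMetric_apply, if_neg hνμ]
    simp [this, partialD_const, hνμ]

/-- Covariant derivative of a vector field proportional to the cosmological observer. -/
theorem covD_flrwMetric (hR : R (x 0) ≠ 0) (hd : DifferentiableAt ℝ R (x 0))
    (hc : curvatureFactor κ (spatial x) ≠ 0) {v : Coord → Coord} {q : Coord → ℝ}
    (hv : ∀ᶠ y in 𝓝 x, v y = q y • cosmologicalObserver y) (μ ν : Fin 4) :
    covD (flrwMetric κ R) v μ ν x =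
      if ν = 0 then partialD μ q x else if ν = μ then deriv R (x 0) / R (x 0) * q x else 0 := by
  have hx := hv.self_of_nhds
  have hsum : ∑ l, christoffel (flrwMetric κ R) ν μ l x * v x l
      = christoffel (flrwMetric κ R) ν μ 0 x * q x := by
    rw [Finset.sum_eq_single 0]
    · simp [hx, cosmologicalObserver]
    · intro l _ hl
      simp [hx, cosmologicalObserver, hl]
    · simp
  rw [covD, hsum, christoffel_flrwMetric_zero hR hd hc]
  by_cases hν : ν = 0
  · subst hν
    have : (fun y => v y 0) =ᶠ[𝓝 x] q := by
      filter_upwards [hv] with y hy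
      simp [hy, cosmologicalObserver]
    simp [partialD_congr this]
  · have : (fun y => v y ν) =ᶠ[𝓝 x] fun _ => 0 := by
      filter_upwards [hv] with y hy
      simp [hy, cosmologicalObserver, hν]
    simp [partialD_congr this, partialD_const, hν]

theorem divergence_flrwMetric (hR : R (x 0) ≠ 0) (hd : DifferentiableAt ℝ R (x 0))
    (hc : curvatureFactor κ (spatial x) ≠ 0) {v : Coord → Coord} {q : Coord → ℝ}
    (hv : ∀ᶠ y in 𝓝 x, v y = q y • cosmologicalObserver y) :
    divergence (flrwMetric κ R) v x = partialD 0 q x + 3 * (deriv R (x 0) / R (x 0)) * q x := by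
  simp only [divergence, covD_flrwMetric hR hd hc hv, Fin.sum_univ_succ]
  simp
  ring

theorem expansion_flrwMetric (hR : R (x 0) ≠ 0) (hd : DifferentiableAt ℝ R (x 0))
    (hc : curvatureFactor κ (spatial x) ≠ 0) {u : Coord → Coord}
    (hu : ∀ᶠ y in 𝓝 x, u y = cosmologicalObserver y) :
    expansion (flrwMetric κ R) u x = 3 * (deriv R (x 0) / R (x 0)) := by
  rw [expansion, divergence_flrwMetric hR hd hc (q := fun _ => 1) (by simpa using hu),
    partialD_const]
  ring

theorem lower_acceleration_flrwMetric (hR : R (x 0) ≠ 0) (hd : DifferentiableAt ℝ R (x 0))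
    (hc : curvatureFactor κ (spatial x) ≠ 0) {u : Coord → Coord}
    (hu : ∀ᶠ y in 𝓝 x, u y = cosmologicalObserver y) :
    lower (flrwMetric κ R) (acceleration (flrwMetric κ R) u) x = 0 := by
  have hx := hu.self_of_nhds
  suffices acceleration (flrwMetric κ R) u x = 0 by
    ext μ
    simp [lower, this]
  ext ν
  simp only [acceleration, covD_flrwMetric hR hd hc (q := fun _ => 1) (by simpa using hu),
    partialD_const, hx, cosmologicalObserver, Pi.zero_apply]
  refine Finset.sum_eq_zero fun μ _ => ?_
  by_cases hμ : μ = 0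
  · subst hμ; simp +contextual
  · simp [hμ]

theorem lower_cosmologicalObserver {u : Coord → Coord} (hx : u x = cosmologicalObserver x) :
    lower (flrwMetric κ R) u x = -Pi.single 0 1 := by
  ext μ
  rw [lower, Finset.sum_eq_single 0]
  · simp [hx, cosmologicalObserver, flrwMetric_apply, Pi.single_apply]
    split_ifs <;> simp
  · intro l _ hl
    simp [hx, cosmologicalObserver, hl]
  · simp

theorem metricSq_cosmologicalObserver {u : Coord → Coord} (hx : u x = cosmologicalObserver x) :
    metricSq (flrwMetric κ R) u x = -1 := by
  simp [metricSq, lower_cosmologicalObserver hx, hx, cosmologicalObserver, Pi.single_apply]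

theorem dot_cosmologicalObserver {u : Coord → Coord} (hx : u x = cosmologicalObserver x)
    (q : Coord → ℝ) : dot u q x = partialD 0 q x := by
  simp [dot, hx, cosmologicalObserver, Pi.single_apply]

end Connection

theorem Gas.adiabaticIndex_sub_one_mul (G : Gas) : (G.adiabaticIndex - 1) * G.cv = G.k := by
  have := G.cv_pos.ne'
  rw [Gas.adiabaticIndex]
  field_simp
  ring

theorem Gas.one_lt_adiabaticIndex (G : Gas) : 1 < G.adiabaticIndex := by
  have := div_pos G.k_pos G.cv_pos
  rw [Gas.adiabaticIndex]
  linarith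

/-! ### Thermodynamics -/

/-- The entropy of a classical ideal gas satisfies `Θ dh = de + p d(1/n)`. -/
theorem gibbs_relation {k cv γ : ℝ} (hk : 0 < k) (hγ : 1 < γ) (hcv : (γ - 1) * cv = k)
    {p n : Coord → ℝ} {x : Coord} (hp : DifferentiableAt ℝ p x) (hn : DifferentiableAt ℝ n x)
    (hp0 : 0 < p x) (hn0 : 0 < n x) (μ : Fin 4) :
    p x / (k * n x) * partialD μ (fun y => cv * Real.log (p y / ((γ - 1) * n y) ^ γ)) x
      = partialD μ (fun y => p y / ((γ - 1) * n y)) x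
        + p x * partialD μ (fun y => 1 / n y) x := by
  have hγ' : 0 < γ - 1 := sub_pos.2 hγ
  have hcv0 : cv ≠ 0 := by
    rintro rfl
    simp [hk.ne] at hcv
  have hlog : (fun y => cv * Real.log (p y / ((γ - 1) * n y) ^ γ)) =ᶠ[𝓝 x]
      fun y => cv * (Real.log (p y) - γ * Real.log ((γ - 1) * n y)) := by
    filter_upwards [hp.continuousAt.eventually (lt_mem_nhds hp0),
      hn.continuousAt.eventually (lt_mem_nhds hn0)] with y hpy hny
    have h1 : 0 < (γ - 1) * n y := mul_pos hγ' hny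
    rw [Real.log_div hpy.ne' (Real.rpow_pos_of_pos h1 _).ne', Real.log_rpow h1]
  have hinv : HasFDerivAt (fun y => (n y)⁻¹) (-(n x ^ 2)⁻¹ • fderiv ℝ n x) x :=
    (hasDerivAt_inv hn0.ne').comp_hasFDerivAt x hn.hasFDerivAt
  have h1 := ((hp.hasFDerivAt.log hp0.ne').fun_sub
    (((hn.hasFDerivAt.const_mul (γ - 1)).log (mul_pos hγ' hn0).ne').const_mul γ)).const_mul cv
  have h2 : HasFDerivAt (fun y => p y / ((γ - 1) * n y)) _ x :=
    ((hp.hasFDerivAt.fun_mul hinv).const_mul (γ - 1)⁻¹).congr_of_eventuallyEq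
      (Eventually.of_forall fun y => by simp only [div_eq_mul_inv, mul_inv]; ring)
  have h3 : HasFDerivAt (fun y => 1 / n y) _ x := hinv.congr_of_eventuallyEq
      (Eventually.of_forall fun y => one_div _)
  rw [partialD_congr hlog, h1.partialD, h2.partialD, h3.partialD, ← hcv]
  simp
  field_simp
  ring

theorem contDiffOn_entropy {m : WithTop ℕ∞} {U : Set Coord} {γ : ℝ} (hγ : 1 < γ) (cv : ℝ)
    {p n : Coord → ℝ} (hp : ContDiffOn ℝ m p U) (hn : ContDiffOn ℝ m n U)
    (hp0 : ∀ x ∈ U, 0 < p x) (hn0 : ∀ x ∈ U, 0 < n x) :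
    ContDiffOn ℝ m (fun x => cv * Real.log (p x / ((γ - 1) * n x) ^ γ)) U := by
  have hnx : ∀ x ∈ U, 0 < (γ - 1) * n x := fun x hx => mul_pos (sub_pos.2 hγ) (hn0 x hx)
  have hnx' : ∀ x ∈ U, 0 < ((γ - 1) * n x) ^ γ := fun x hx => Real.rpow_pos_of_pos (hnx x hx) _
  exact contDiffOn_const.mul ((hp.div ((contDiffOn_const.mul hn).rpow_const_of_ne
    fun x hx => (hnx x hx).ne') fun x hx => (hnx' x hx).ne').log
    fun x hx => (div_pos (hp0 x hx) (hnx' x hx)).ne')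

/-! ### Powers of the expansion factor -/

theorem hasDerivAt_scale {R : ℝ → ℝ} {R₀ t : ℝ} (hR₀ : 0 < R₀) (hR : 0 < R t)
    (hd : DifferentiableAt ℝ R t) (a : ℝ) :
    HasDerivAt (fun t => (R₀ / R t) ^ a) (-a * (deriv R t / R t) * (R₀ / R t) ^ a) t := by
  have h1 : HasDerivAt (fun t => R₀ / R t) (-(R₀ * deriv R t) / R t ^ 2) t := by
    simpa using (hasDerivAt_const t R₀).fun_div hd.hasDerivAt hR.ne'
  convert h1.rpow_const (p := a) (Or.inl (div_pos hR₀ hR).ne') using 1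
  rw [Real.rpow_sub_one (div_pos hR₀ hR).ne']
  field_simp

section Scale

variable {I : Set ℝ} {D : Set (Fin 3 → ℝ)} {R : ℝ → ℝ} {R₀ : ℝ}

theorem contDiffOn_scale {m : WithTop ℕ∞} (hR₀ : 0 < R₀) (hR_pos : ∀ t ∈ I, 0 < R t)
    (hR : ContDiffOn ℝ m R I) (a : ℝ) :
    ContDiffOn ℝ m (fun x : Coord => (R₀ / R (x 0)) ^ a) (flrwDomain I D) := by
  have h : ContDiffOn ℝ m (fun t => (R₀ / R t) ^ a) I :=
    (contDiffOn_const.div hR fun t ht => (hR_pos t ht).ne').rpow_const_of_ne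
      fun t ht => (div_pos hR₀ (hR_pos t ht)).ne'
  exact h.comp (contDiff_apply ℝ ℝ (0 : Fin 4)).contDiffOn fun x hx => hx.1

theorem contDiffOn_comp_spatial {m : WithTop ℕ∞} {N : (Fin 3 → ℝ) → ℝ} (hN : ContDiffOn ℝ m N D) :
    ContDiffOn ℝ m (fun x : Coord => N (spatial x)) (flrwDomain I D) :=
  hN.comp contDiff_spatial.contDiffOn fun _ hx => hx.2

theorem differentiableAt_scale {x : Coord} (hR₀ : 0 < R₀) (hR : 0 < R (x 0))
    (hd : DifferentiableAt ℝ R (x 0)) (a : ℝ) :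
    DifferentiableAt ℝ (fun y : Coord => (R₀ / R (y 0)) ^ a) x :=
  DifferentiableAt.comp (g := fun t => (R₀ / R t) ^ a) (f := fun y : Coord => y 0) x
    (hasDerivAt_scale hR₀ hR hd a).differentiableAt (hasFDerivAt_time x).differentiableAt

/-- If `q̇ = -a (Ṙ/R) q` then `q (R₀/R)^(-a)` is conserved. -/
theorem partialD_zero_mul_scale {q : Coord → ℝ} {x : Coord} {a : ℝ} (hR₀ : 0 < R₀)
    (hR : 0 < R (x 0)) (hd : DifferentiableAt ℝ R (x 0)) (hq : DifferentiableAt ℝ q x)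
    (h : partialD 0 q x = -a * (deriv R (x 0) / R (x 0)) * q x) :
    partialD 0 (fun y => q y * (R₀ / R (y 0)) ^ (-a)) x = 0 := by
  rw [partialD_mul hq (differentiableAt_scale hR₀ hR hd _),
    partialD_time_zero (φ := fun t => (R₀ / R t) ^ (-a)) (hasDerivAt_scale hR₀ hR hd _), h]
  ring

/-- `(R₀/R)^a` times a function of the spatial coordinates decays at the rate `a Ṙ/R`. -/
theorem partialD_zero_spatial_mul_scale {N : (Fin 3 → ℝ) → ℝ} {x : Coord} (hR₀ : 0 < R₀)
    (hR : 0 < R (x 0)) (hd : DifferentiableAt ℝ R (x 0))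
    (hN : DifferentiableAt ℝ N (spatial x)) (a : ℝ) :
    partialD 0 (fun y => N (spatial y) * (R₀ / R (y 0)) ^ a) x
      = -a * (deriv R (x 0) / R (x 0)) * (N (spatial x) * (R₀ / R (x 0)) ^ a) := by
  rw [partialD_mul (f := fun y => N (spatial y))
      (hN.comp x (spatialCLM.differentiableAt (x := x))) (differentiableAt_scale hR₀ hR hd _),
    partialD_time_zero (φ := fun t => (R₀ / R t) ^ a) (hasDerivAt_scale hR₀ hR hd _),
    partialD_zero_spatial hN]
  ring

end Scale

/-! ### Comoving test solutions -/

section Comoving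

variable {r : ℕ∞} {κ : ℝ} {I : Set ℝ} {R : ℝ → ℝ} {D : Set (Fin 3 → ℝ)} {R₀ : ℝ}

/-- The comoving fluids determined by a constant `p₀`, a function `N` of the spatial coordinates
and a constant `s₀`, on the domain `U`. -/
def IsComovingForm (R : ℝ → ℝ) (R₀ k cv γ p₀ : ℝ) (N : (Fin 3 → ℝ) → ℝ) (s₀ : ℝ) (F : Fluid)
    (U : Set Coord) : Prop :=
  ∀ x ∈ U,
    F.ρ x = N (spatial x) * (R₀ / R (x 0)) ^ 3
      + p₀ / (γ - 1) * (R₀ / R (x 0)) ^ (3 * γ) ∧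
    F.p x = p₀ * (R₀ / R (x 0)) ^ (3 * γ) ∧
    F.n x = N (spatial x) * (R₀ / R (x 0)) ^ 3 ∧
    F.Θ x = p₀ / (k * N (spatial x)) * (R₀ / R (x 0)) ^ (3 * (γ - 1)) ∧
    F.e x = F.p x / ((γ - 1) * F.ρ x - F.p x) ∧
    F.s x = s₀ + cv * Real.log (F.p x / (F.ρ x * (γ - 1) - F.p x) ^ γ)

/-- `(R₀/R)^(3γ) / (R₀/R)^3 = (R₀/R)^(3(γ-1))`. -/
theorem rpow_three_mul_sub_one {z : ℝ} (hz : 0 < z) (γ : ℝ) :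
    z ^ (3 * (γ - 1)) = z ^ (3 * γ) / z ^ 3 := by
  rw [mul_sub, mul_one, Real.rpow_sub hz]
  norm_num

theorem IsCIGSolution.exists_form (hr : 1 ≤ r) (hI_open : IsOpen I) (hI : IsConnected I)
    (hR : ContDiffOn ℝ r R I) (hR_pos : ∀ t ∈ I, 0 < R t) (hD_open : IsOpen D)
    (hD : IsConnected D) (hD_reg : ∀ y ∈ D, curvatureFactor κ y ≠ 0) (hR₀ : 0 < R₀) {G : Gas}
    {F : Fluid} (hF : F.IsComoving (flrwDomain I D))
    (h : IsCIGSolution r (flrwMetric κ R) (flrwDomain I D) G F) :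
    ∃ (p₀ : ℝ) (N : (Fin 3 → ℝ) → ℝ) (s₀ : ℝ), 0 < p₀ ∧ ContDiffOn ℝ r N D ∧ (∀ y ∈ D, 0 < N y) ∧
      IsComovingForm R R₀ G.k G.cv G.adiabaticIndex p₀ N s₀ F (flrwDomain I D) := by
  have hr0 : (r : WithTop ℕ∞) ≠ 0 := by
    have : r ≠ 0 := (zero_lt_one.trans_le hr).ne'
    exact_mod_cast this
  set γ := G.adiabaticIndex
  set U := flrwDomain I D
  have hγ : 0 < γ - 1 := sub_pos.2 G.one_lt_adiabaticIndex
  have hcv : (γ - 1) * G.cv = G.k := G.adiabaticIndex_sub_one_mul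
  have hU : IsOpen U := isOpen_flrwDomain hI_open hD_open
  have hUc : IsConnected U := isConnected_flrwDomain hI hD
  have diff : ∀ {f : Coord → ℝ}, ContDiffOn ℝ r f U → ∀ x ∈ U, DifferentiableAt ℝ f x :=
    fun hf x hx => (hf.contDiffAt (hU.mem_nhds hx)).differentiableAt hr0
  have hd : ∀ x ∈ U, DifferentiableAt ℝ R (x 0) := fun x hx =>
    (hR.contDiffAt (hI_open.mem_nhds hx.1)).differentiableAt hr0
  have hu : ∀ x ∈ U, ∀ᶠ y in 𝓝 x, F.u y = cosmologicalObserver y := fun x hx => by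
    filter_upwards [hU.mem_nhds hx] with y hy using hF y hy
  have hRp : ∀ x ∈ U, 0 < R (x 0) := fun x hx => hR_pos _ hx.1
  have hz : ∀ x ∈ U, 0 < R₀ / R (x 0) := fun x hx => div_pos hR₀ (hRp x hx)
  have hne : ∀ x ∈ U, F.n x * F.e x = F.p x / (γ - 1) := fun x hx => by
    rw [h.state_p x hx, h.state_e x hx, ← hcv]
    field_simp
  have hρ : ∀ x ∈ U, F.ρ x = F.n x + (γ - 1)⁻¹ * F.p x := fun x hx => by
    rw [h.decomposition x hx, mul_add, mul_one, hne x hx]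
    ring
  -- spatial homogeneity of the pressure
  have hp_succ : ∀ x ∈ U, ∀ i : Fin 3, partialD i.succ F.p x = 0 := fun x hx i => by
    have := h.momentum x hx i.succ
    rw [lower_acceleration_flrwMetric (hRp x hx).ne' (hd x hx) (hD_reg _ hx.2) (hu x hx),
      lower_cosmologicalObserver (hF x hx)] at this
    simpa using this
  -- evolution of the matter density and of the pressure
  have hn_dot : ∀ x ∈ U, partialD 0 F.n x = -3 * (deriv R (x 0) / R (x 0)) * F.n x := fun x hx => by
    have := h.matter x hx
    rw [divergence_flrwMetric (q := F.n) (hRp x hx).ne' (hd x hx) (hD_reg _ hx.2)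
      (by filter_upwards [hu x hx] with y hy using by rw [hy])] at this
    linarith
  have hp_dot : ∀ x ∈ U, partialD 0 F.p x = -(3 * γ) * (deriv R (x 0) / R (x 0)) * F.p x :=
    fun x hx => by
    have h1 := h.energy x hx
    rw [dot_cosmologicalObserver (hF x hx), expansion_flrwMetric (hRp x hx).ne' (hd x hx)
      (hD_reg _ hx.2) (hu x hx), hρ x hx, partialD_congr (g := fun y => F.n y + (γ - 1)⁻¹ * F.p y)
      (by filter_upwards [hU.mem_nhds hx] with y hy using hρ y hy),
      partialD_add (diff h.contDiffOn_n x hx) ((diff h.contDiffOn_p x hx).const_mul _),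
      partialD_mul (differentiableAt_const _) (diff h.contDiffOn_p x hx), partialD_const,
      hn_dot x hx] at h1
    linear_combination (γ - 1) * h1 - (partialD 0 F.p x + 3 * (deriv R (x 0) / R (x 0)) * F.p x)
      * mul_inv_cancel₀ hγ.ne'
  have hscale : ∀ x ∈ U, ∀ a : ℝ, DifferentiableAt ℝ (fun y : Coord => (R₀ / R (y 0)) ^ a) x :=
    fun x hx a => differentiableAt_scale hR₀ (hRp x hx) (hd x hx) a
  obtain ⟨p₀, hp₀⟩ := exists_const_of_partialD_eq_zero hU hUc
    (f := fun y => F.p y * (R₀ / R (y 0)) ^ (-(3 * γ)))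
    (fun x hx => ((diff h.contDiffOn_p x hx).fun_mul (hscale x hx _)).differentiableWithinAt)
    (fun x hx μ => by
      refine Fin.cases ?_ (fun i => ?_) μ
      · exact partialD_zero_mul_scale hR₀ (hRp x hx) (hd x hx) (diff h.contDiffOn_p x hx)
          (hp_dot x hx)
      · rw [partialD_mul (diff h.contDiffOn_p x hx) (hscale x hx _), hp_succ x hx,
          partialD_time_succ (φ := fun t => (R₀ / R t) ^ (-(3 * γ)))
            (hasDerivAt_scale hR₀ (hRp x hx) (hd x hx) _).differentiableAt]
        ring)
  have hp : ∀ x ∈ U, F.p x = p₀ * (R₀ / R (x 0)) ^ (3 * γ) := fun x hx => by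
    rw [← hp₀ x hx, mul_assoc, ← Real.rpow_add (hz x hx)]
    simp
  obtain ⟨t₀, ht₀⟩ := hI.nonempty
  let N : (Fin 3 → ℝ) → ℝ := fun y => F.n (event t₀ y) * (R₀ / R t₀) ^ (-3 : ℝ)
  have hn : ∀ x ∈ U, F.n x = N (spatial x) * (R₀ / R (x 0)) ^ 3 := fun x hx => by
    have := eq_of_partialD_zero_eq_zero hI_open hI
      (f := fun y => F.n y * (R₀ / R (y 0)) ^ (-3 : ℝ))
      (fun x hx => (diff h.contDiffOn_n x hx).fun_mul (hscale x hx _))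
      (fun x hx => partialD_zero_mul_scale hR₀ (hRp x hx) (hd x hx) (diff h.contDiffOn_n x hx)
        (hn_dot x hx)) ht₀ hx
    rw [show N (spatial x) = F.n x * (R₀ / R (x 0)) ^ (-3 : ℝ) from this.symm, mul_assoc,
      ← Real.rpow_natCast, ← Real.rpow_add (hz x hx)]
    norm_num
  have hNpos : ∀ y ∈ D, 0 < N y := fun y hy =>
    mul_pos (h.n_pos _ ⟨ht₀, hy⟩) (Real.rpow_pos_of_pos (div_pos hR₀ (hR_pos _ ht₀)) _)
  have hNc : ContDiffOn ℝ r N D :=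
    (h.contDiffOn_n.comp (contDiff_event.comp (contDiff_const.prodMk contDiff_id)).contDiffOn
      fun y hy => ⟨ht₀, hy⟩).mul contDiffOn_const
  have hΘ : ∀ x ∈ U, F.Θ x = F.p x / (G.k * F.n x) := fun x hx => by
    have := (h.n_pos x hx).ne'
    have := G.k_pos.ne'
    rw [h.state_p x hx]
    field_simp
  have he : ∀ x ∈ U, F.e x = F.p x / ((γ - 1) * F.n x) := fun x hx => by
    have := (h.n_pos x hx).ne'
    rw [← div_div, ← hne x hx]
    field_simp
  have hn' : ∀ x ∈ U, (γ - 1) * F.ρ x - F.p x = (γ - 1) * F.n x := fun x hx => by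
    rw [hρ x hx]
    field_simp
    ring
  -- integration of the entropy
  set S : Coord → ℝ := fun y => G.cv * Real.log (F.p y / ((γ - 1) * F.n y) ^ γ) with hS
  have hSd : ∀ x ∈ U, DifferentiableAt ℝ S x :=
    diff (contDiffOn_entropy G.one_lt_adiabaticIndex G.cv h.contDiffOn_p h.contDiffOn_n h.p_pos
      h.n_pos)
  obtain ⟨s₀, hs₀⟩ := exists_const_of_partialD_eq_zero hU hUc (f := fun y => F.s y + -1 * S y)
    (fun x hx => ((diff h.contDiffOn_s x hx).fun_add
      ((hSd x hx).const_mul _)).differentiableWithinAt)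
    (fun x hx μ => by
      have h1 := h.thermal x hx μ
      rw [partialD_congr (f := F.e) (g := fun y => F.p y / ((γ - 1) * F.n y))
        (by filter_upwards [hU.mem_nhds hx] with y hy using he y hy),
        ← gibbs_relation G.k_pos G.one_lt_adiabaticIndex hcv (diff h.contDiffOn_p x hx)
        (diff h.contDiffOn_n x hx) (h.p_pos x hx) (h.n_pos x hx), hΘ x hx] at h1
      have h2 := mul_left_cancel₀
        (div_pos (h.p_pos x hx) (mul_pos G.k_pos (h.n_pos x hx))).ne' h1
      rw [partialD_add (diff h.contDiffOn_s x hx) ((hSd x hx).const_mul _),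
        partialD_mul (differentiableAt_const _) (hSd x hx), partialD_const, h2]
      ring)
  have hp₀_pos : 0 < p₀ := by
    obtain ⟨x, hx⟩ := hUc.nonempty
    rw [← hp₀ x hx]
    exact mul_pos (h.p_pos x hx) (Real.rpow_pos_of_pos (hz x hx) _)
  refine ⟨p₀, N, s₀, hp₀_pos, hNc, hNpos, fun x hx => ⟨?_, hp x hx, hn x hx, ?_, ?_, ?_⟩⟩
  · rw [hρ x hx, hn x hx, hp x hx]
    ring
  · rw [hΘ x hx, hn x hx, hp x hx, rpow_three_mul_sub_one (hz x hx)]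
    ring
  · rw [he x hx, hn' x hx]
  · rw [mul_comm (F.ρ x), hn' x hx]
    have := hs₀ x hx
    simp only [hS] at this
    linarith

theorem isCIGSolution_of_form (hr : 1 ≤ r) (hI_open : IsOpen I)
    (hR : ContDiffOn ℝ r R I) (hR_pos : ∀ t ∈ I, 0 < R t) (hD_open : IsOpen D)
    (hD_reg : ∀ y ∈ D, curvatureFactor κ y ≠ 0) (hR₀ : 0 < R₀) {G : Gas}
    {F : Fluid} (hF : F.IsComoving (flrwDomain I D)) {p₀ s₀ : ℝ} {N : (Fin 3 → ℝ) → ℝ}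
    (hp₀ : 0 < p₀) (hNc : ContDiffOn ℝ r N D) (hNpos : ∀ y ∈ D, 0 < N y)
    (h : IsComovingForm R R₀ G.k G.cv G.adiabaticIndex p₀ N s₀ F (flrwDomain I D)) :
    IsCIGSolution r (flrwMetric κ R) (flrwDomain I D) G F := by
  have hr0 : (r : WithTop ℕ∞) ≠ 0 := by
    have : r ≠ 0 := (zero_lt_one.trans_le hr).ne'
    exact_mod_cast this
  set γ := G.adiabaticIndex
  set U := flrwDomain I D
  have hγ : 0 < γ - 1 := sub_pos.2 G.one_lt_adiabaticIndex
  have hcv : (γ - 1) * G.cv = G.k := G.adiabaticIndex_sub_one_mul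
  have hk := G.k_pos
  have hU : IsOpen U := isOpen_flrwDomain hI_open hD_open
  have diff : ∀ {f : Coord → ℝ}, ContDiffOn ℝ r f U → ∀ x ∈ U, DifferentiableAt ℝ f x :=
    fun hf x hx => (hf.contDiffAt (hU.mem_nhds hx)).differentiableAt hr0
  have hd : ∀ x ∈ U, DifferentiableAt ℝ R (x 0) := fun x hx =>
    (hR.contDiffAt (hI_open.mem_nhds hx.1)).differentiableAt hr0
  have hu : ∀ x ∈ U, ∀ᶠ y in 𝓝 x, F.u y = cosmologicalObserver y := fun x hx => by
    filter_upwards [hU.mem_nhds hx] with y hy using hF y hy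
  have hRp : ∀ x ∈ U, 0 < R (x 0) := fun x hx => hR_pos _ hx.1
  have hz : ∀ x ∈ U, 0 < R₀ / R (x 0) := fun x hx => div_pos hR₀ (hRp x hx)
  have hp : ∀ x ∈ U, F.p x = p₀ * (R₀ / R (x 0)) ^ (3 * γ) := fun x hx => (h x hx).2.1
  have hn : ∀ x ∈ U, F.n x = N (spatial x) * (R₀ / R (x 0)) ^ (3 : ℝ) := fun x hx => by
    rw [(h x hx).2.2.1]
    norm_num
  have hp_pos : ∀ x ∈ U, 0 < F.p x := fun x hx => by
    rw [hp x hx]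
    exact mul_pos hp₀ (Real.rpow_pos_of_pos (hz x hx) _)
  have hn_pos : ∀ x ∈ U, 0 < F.n x := fun x hx => by
    rw [hn x hx]
    exact mul_pos (hNpos _ hx.2) (Real.rpow_pos_of_pos (hz x hx) _)
  have hρ : ∀ x ∈ U, F.ρ x = F.n x + (γ - 1)⁻¹ * F.p x := fun x hx => by
    rw [(h x hx).1, (h x hx).2.2.1, hp x hx]
    ring
  have hn' : ∀ x ∈ U, (γ - 1) * F.ρ x - F.p x = (γ - 1) * F.n x := fun x hx => by
    rw [hρ x hx]
    field_simp
    ring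
  have hΘ : ∀ x ∈ U, F.Θ x = F.p x / (G.k * F.n x) := fun x hx => by
    rw [(h x hx).2.2.2.1, (h x hx).2.2.1, hp x hx, rpow_three_mul_sub_one (hz x hx)]
    ring
  have he : ∀ x ∈ U, F.e x = F.p x / ((γ - 1) * F.n x) := fun x hx => by
    rw [(h x hx).2.2.2.2.1, hn' x hx]
  have hs : ∀ x ∈ U, F.s x = s₀ + G.cv * Real.log (F.p x / ((γ - 1) * F.n x) ^ γ) :=
    fun x hx => by rw [(h x hx).2.2.2.2.2, mul_comm (F.ρ x), hn' x hx]
  have cp : ContDiffOn ℝ r F.p U :=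
    (contDiffOn_const.mul (contDiffOn_scale hR₀ hR_pos hR (3 * γ))).congr hp
  have cn : ContDiffOn ℝ r F.n U :=
    ((contDiffOn_comp_spatial hNc).mul (contDiffOn_scale hR₀ hR_pos hR 3)).congr hn
  have cS : ContDiffOn ℝ r (fun x => G.cv * Real.log (F.p x / ((γ - 1) * F.n x) ^ γ)) U :=
    contDiffOn_entropy G.one_lt_adiabaticIndex G.cv cp cn hp_pos hn_pos
  have hp_dot : ∀ x ∈ U, partialD 0 F.p x = -(3 * γ) * (deriv R (x 0) / R (x 0)) * F.p x :=
    fun x hx => by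
    rw [partialD_congr (g := fun y => p₀ * (R₀ / R (y 0)) ^ (3 * γ))
      (by filter_upwards [hU.mem_nhds hx] with y hy using hp y hy), hp x hx]
    exact partialD_zero_spatial_mul_scale (N := fun _ => p₀) hR₀ (hRp x hx) (hd x hx)
      (differentiableAt_const _) _
  have hn_dot : ∀ x ∈ U, partialD 0 F.n x = -3 * (deriv R (x 0) / R (x 0)) * F.n x := fun x hx => by
    rw [partialD_congr (g := fun y => N (spatial y) * (R₀ / R (y 0)) ^ (3 : ℝ))
      (by filter_upwards [hU.mem_nhds hx] with y hy using hn y hy), hn x hx]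
    exact partialD_zero_spatial_mul_scale hR₀ (hRp x hx) (hd x hx)
      ((hNc.contDiffAt (hD_open.mem_nhds hx.2)).differentiableAt hr0) _
  exact {
    contDiffOn_u := contDiffOn_const.congr hF
    contDiffOn_ρ := (cn.add (contDiffOn_const.mul cp)).congr hρ
    contDiffOn_p := cp
    contDiffOn_n := cn
    contDiffOn_e := (cp.div (contDiffOn_const.mul cn)
      fun x hx => (mul_pos hγ (hn_pos x hx)).ne').congr he
    contDiffOn_s := (contDiffOn_const.add cS).congr hs
    contDiffOn_Θ := (cp.div (contDiffOn_const.mul cn)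
      fun x hx => (mul_pos hk (hn_pos x hx)).ne').congr hΘ
    unit := fun x hx => metricSq_cosmologicalObserver (hF x hx)
    momentum := fun x hx μ => by
      rw [lower_acceleration_flrwMetric (hRp x hx).ne' (hd x hx) (hD_reg _ hx.2) (hu x hx),
        lower_cosmologicalObserver (hF x hx), dot_cosmologicalObserver (hF x hx)]
      refine Fin.cases ?_ (fun i => ?_) μ
      · simp
      · rw [partialD_congr (g := fun y => p₀ * (R₀ / R (y 0)) ^ (3 * γ))
          (by filter_upwards [hU.mem_nhds hx] with y hy using hp y hy),
          partialD_time_succ (φ := fun t => p₀ * (R₀ / R t) ^ (3 * γ))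
            ((hasDerivAt_scale hR₀ (hRp x hx) (hd x hx) _).differentiableAt.const_mul _)]
        simp
    energy := fun x hx => by
      rw [dot_cosmologicalObserver (hF x hx), expansion_flrwMetric (hRp x hx).ne' (hd x hx)
        (hD_reg _ hx.2) (hu x hx), hρ x hx,
        partialD_congr (g := fun y => F.n y + (γ - 1)⁻¹ * F.p y)
        (by filter_upwards [hU.mem_nhds hx] with y hy using hρ y hy),
        partialD_add (diff cn x hx) ((diff cp x hx).const_mul _),
        partialD_mul (differentiableAt_const _) (diff cp x hx), partialD_const,
        hn_dot x hx, hp_dot x hx]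
      field_simp
      ring
    decomposition := fun x hx => by
      have := (hn_pos x hx).ne'
      rw [hρ x hx, he x hx]
      field_simp
    n_pos := hn_pos
    matter := fun x hx => by
      rw [divergence_flrwMetric (q := F.n) (hRp x hx).ne' (hd x hx) (hD_reg _ hx.2)
        (by filter_upwards [hu x hx] with y hy using by rw [hy]), hn_dot x hx]
      ring
    thermal := fun x hx μ => by
      rw [partialD_congr (f := F.e) (g := fun y => F.p y / ((γ - 1) * F.n y))
        (by filter_upwards [hU.mem_nhds hx] with y hy using he y hy),
        ← gibbs_relation hk G.one_lt_adiabaticIndex hcv (diff cp x hx) (diff cn x hx)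
        (hp_pos x hx) (hn_pos x hx), hΘ x hx, partialD_congr (f := F.s)
        (by filter_upwards [hU.mem_nhds hx] with y hy using hs y hy),
        partialD_add (differentiableAt_const _) (diff cS x hx), partialD_const, zero_add]
    state_p := fun x hx => by
      have := (hn_pos x hx).ne'
      rw [hΘ x hx]
      field_simp
    p_pos := hp_pos
    state_e := fun x hx => by
      have := (hn_pos x hx).ne'
      have := G.cv_pos.ne'
      rw [hΘ x hx, he x hx, ← hcv]
      field_simp }

theorem exists_comoving_solution (hr : 1 ≤ r) (hI_open : IsOpen I)
    (hR : ContDiffOn ℝ r R I) (hR_pos : ∀ t ∈ I, 0 < R t) (hD_open : IsOpen D)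
    (hD_reg : ∀ y ∈ D, curvatureFactor κ y ≠ 0) {γ k : ℝ} (hγ : 1 < γ) (hk : 0 < k) :
    ∃ G : Gas, G.k = k ∧ G.adiabaticIndex = γ ∧
      ∃ F : Fluid, F.IsComoving (flrwDomain I D) ∧
        IsCIGSolution r (flrwMetric κ R) (flrwDomain I D) G F := by
  have hγ' : 0 < γ - 1 := sub_pos.2 hγ
  let G : Gas := ⟨k, k / (γ - 1), hk, div_pos hk hγ'⟩
  have hG : G.adiabaticIndex = γ := by
    simp only [Gas.adiabaticIndex, G]
    field_simp
    ring
  let ρ : Coord → ℝ := fun x => 1 * (1 / R (x 0)) ^ 3 + 1 / (γ - 1) * (1 / R (x 0)) ^ (3 * γ)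
  let p : Coord → ℝ := fun x => 1 * (1 / R (x 0)) ^ (3 * γ)
  let F : Fluid :=
    { u := cosmologicalObserver
      ρ := ρ
      p := p
      n := fun x => 1 * (1 / R (x 0)) ^ 3
      e := fun x => p x / ((γ - 1) * ρ x - p x)
      s := fun x => 0 + G.cv * Real.log (p x / (ρ x * (γ - 1) - p x) ^ γ)
      Θ := fun x => 1 / (k * 1) * (1 / R (x 0)) ^ (3 * (γ - 1)) }
  have hF : F.IsComoving (flrwDomain I D) := fun _ _ => rfl
  refine ⟨G, rfl, hG, F, hF, isCIGSolution_of_form hr hI_open hR hR_pos hD_open hD_reg one_pos hF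
    (p₀ := 1) (s₀ := 0) (N := fun _ => 1) one_pos contDiffOn_const (fun _ _ => one_pos) ?_⟩
  rw [hG]
  exact fun x _ => ⟨rfl, rfl, rfl, rfl, rfl, rfl⟩

end Comoving

end ClassicalIdealGas

theorem mainTheorem10
    -- an arbitrary FLRW universe: curvature index, expansion factor, coordinate domain
    (r : ℕ∞) (hr : 1 ≤ r)
    (κ : ℝ) (hκ : κ = 0 ∨ κ = 1 ∨ κ = -1)
    (I : Set ℝ) (hI_open : IsOpen I) (hI : IsConnected I)
    (R : ℝ → ℝ) (hR : ContDiffOn ℝ r R I) (hR_pos : ∀ t ∈ I, 0 < R t)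
    (D : Set (Fin 3 → ℝ)) (hD_open : IsOpen D) (hD : IsConnected D)
    (hD_reg : ∀ y ∈ D, ClassicalIdealGas.curvatureFactor κ y ≠ 0)
    (R₀ : ℝ) (hR₀ : 0 < R₀) :
    -- comoving test solutions exist, for any adiabatic index
    (∀ γ : ℝ, 1 < γ → ∀ k : ℝ, 0 < k →
      ∃ G : ClassicalIdealGas.Gas, G.k = k ∧ G.adiabaticIndex = γ ∧
        ∃ F : ClassicalIdealGas.Fluid,
          F.IsComoving (ClassicalIdealGas.flrwDomain I D) ∧
          ClassicalIdealGas.IsCIGSolution r (ClassicalIdealGas.flrwMetric κ R)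
            (ClassicalIdealGas.flrwDomain I D) G F) ∧
    -- and they are exactly the following ones
    (∀ (G : ClassicalIdealGas.Gas) (γ : ℝ), γ = G.adiabaticIndex →
      ∀ F : ClassicalIdealGas.Fluid, F.IsComoving (ClassicalIdealGas.flrwDomain I D) →
        (ClassicalIdealGas.IsCIGSolution r (ClassicalIdealGas.flrwMetric κ R)
            (ClassicalIdealGas.flrwDomain I D) G F ↔
          ∃ (p₀ : ℝ) (N : (Fin 3 → ℝ) → ℝ) (s₀ : ℝ),
            0 < p₀ ∧ ContDiffOn ℝ r N D ∧ (∀ y ∈ D, 0 < N y) ∧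
            ∀ x ∈ ClassicalIdealGas.flrwDomain I D,
              F.ρ x = N (ClassicalIdealGas.spatial x) * (R₀ / R (x 0)) ^ 3
                + p₀ / (γ - 1) * (R₀ / R (x 0)) ^ (3 * γ) ∧
              F.p x = p₀ * (R₀ / R (x 0)) ^ (3 * γ) ∧
              F.n x = N (ClassicalIdealGas.spatial x) * (R₀ / R (x 0)) ^ 3 ∧
              F.Θ x = p₀ / (G.k * N (ClassicalIdealGas.spatial x))
                * (R₀ / R (x 0)) ^ (3 * (γ - 1)) ∧
              F.e x = F.p x / ((γ - 1) * F.ρ x - F.p x) ∧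
              F.s x = s₀ + G.cv * Real.log (F.p x / (F.ρ x * (γ - 1) - F.p x) ^ γ))) := by
  refine ⟨fun γ hγ k hk => ClassicalIdealGas.exists_comoving_solution hr hI_open hR hR_pos hD_open
    hD_reg hγ hk, ?_⟩
  rintro G γ rfl F hF
  constructor
  · exact fun h => h.exists_form hr hI_open hI hR hR_pos hD_open hD hD_reg hR₀ hF
  · rintro ⟨p₀, N, s₀, hp₀, hNc, hNpos, h⟩
    exact ClassicalIdealGas.isCIGSolution_of_form hr hI_open hR hR_pos hD_open hD_reg hR₀ hF
      hp₀ hNc hNpos h
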